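/- Let $R$ be a commutative artinian ring and let $(\mathcal C,\mathbb E,\mathfrak s)$ be an artin extriangulated $R$-category. That is, $\mathcal C$ is an additive $R$-linear category with an extriangulated structure in the sense of Nakaoka and Palu whose bifunctor $\mathbb E\colon\mathcal C^{\mathrm{op}}\times\mathcal C\to\mathrm{Ab}$ takes values in $R$-modules and is $R$-bilinear; all $R$-modules $\operatorname{Hom}_{\mathcal C}(X,Y)$ and $\mathbb E(X,Y)$ are finitely generated; and every object of $\mathcal C$ is a finite direct sum of objects with local endomorphism rings. Assume that $\mathcal C$ has enough projectives and enough injectives: every object $Z$ admits an $\mathbb E$-triangle $X\to P\to Z\dashrightarrow$ with $P$ projective (morphisms from $P$ lift along $y$ for every $\mathbb E$-triangle $A\xrightarrow{x}B\xrightarrow{y}C\dashrightarrow$), and dually for injectives. Let $t\ge 0$, let $\Theta=\{\Theta(i)\}_{i=1}^{t}$ be a family of objects of $\mathcal C$, and let $\le$ be a linear order on the set $\{1,\dots,t\}$ such that $\mathbb E(\Theta(j),\Theta(i))=0$ for all $j\ge i$. Let $\mathcal F(\Theta)$ be the class of objects $M$ for which there are $n\ge 0$ and $\mathbb E$-triangles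 $M_{i-1}\to M_i\to X_i\dashrightarrow$ $(0\le i\le n)$ with $M_{-1}=0=X_0$, $M_n=M$ and $X_i\in\Theta$ for $1\le i\le n$. Let $\Theta^{\oplus}$ be the class of objects isomorphic to finite direct sums of copies of objects of $\Theta$ (the empty sum included). For classes $\mathcal X,\mathcal Y$ of objects let $\mathcal X\ast\mathcal Y$ be the class of objects $M$ that admit an $\mathbb E$-triangle $X\to M\to Y\dashrightarrow$ with $X\in\mathcal X$ and $Y\in\mathcal Y$. Then $$\mathcal F(\Theta)=\underbrace{\Theta^{\oplus}\ast\cdots\ast\Theta^{\oplus}}_{t\ \text{factors}}$$ (for $t=0$ the right-hand side is the class of zero objects), and $\mathcal F(\Theta)$ is functorially finite in $\mathcal C$: for every object $C$ of $\mathcal C$ there is a morphism $f\colon X\to C$ with $X\in\mathcal F(\Theta)$ through which every morphism from an object of $\mathcal F(\Theta)$ to $C$ factors, and there is a morphism $g\colon C\to X'$ with $X'\in\mathcal F(\Theta)$ through which every morphism from $C$ to an object of $\mathcal F(\Theta)$ factors. -/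

import Mathlib

open CategoryTheory CategoryTheory.Limits

universe w v u

attribute [local instance] hasBinaryBiproducts_of_finite_biproducts

/-- An extriangulated structure on an additive category `C`: a biadditive functor
`E : Cᵒᵖ × C ⥤ Ab` together with an additive realization, subject to (ET3), (ET4) and
their duals. The realization sends `δ ∈ E(Z, X)` to an equivalence class of sequences
`X ⟶ Y ⟶ Z`; it is recorded as the relation `Realizes δ x y`, saying that the sequence
`(x, y)` belongs to the class of `δ`. -/
structure ExtriangulatedStructure (C : Type u) [Category.{v} C] [Preadditive C]
    [HasFiniteBiproducts C] where
  /-- the functor `E`, contravariant in the first and covariant in the second variable -/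
  E : Cᵒᵖ ⥤ C ⥤ AddCommGrpCat.{w}
  /-- `E` is additive in the second variable -/
  additive_right : ∀ Z : C, (E.obj (Opposite.op Z)).Additive
  /-- `E` is additive in the first variable -/
  additive_left : ∀ X : C, (E.flip.obj X).Additive
  /-- `Realizes δ x y`: the sequence `(x, y)` belongs to the class assigned to `δ` -/
  Realizes : ∀ {X Y Z : C}, (E.obj (Opposite.op Z)).obj X → (X ⟶ Y) → (Y ⟶ Z) → Prop
  /-- every extension is realized by some sequence -/
  exists_realizes : ∀ {X Z : C} (δ : (E.obj (Opposite.op Z)).obj X),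
    ∃ (Y : C) (x : X ⟶ Y) (y : Y ⟶ Z), Realizes δ x y
  /-- the sequences that realize `δ` form exactly one equivalence class -/
  realizes_iff : ∀ {X Y Y' Z : C} {δ : (E.obj (Opposite.op Z)).obj X}
    {x : X ⟶ Y} {y : Y ⟶ Z}, Realizes δ x y → ∀ (x' : X ⟶ Y') (y' : Y' ⟶ Z),
      (Realizes δ x' y' ↔ ∃ b : Y ≅ Y', x ≫ b.hom = x' ∧ b.hom ≫ y' = y)
  /-- every morphism of extensions is realized by a morphism of sequences -/
  realization : ∀ {X Y Z X' Y' Z' : C}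
    {δ : (E.obj (Opposite.op Z)).obj X} {δ' : (E.obj (Opposite.op Z')).obj X'}
    {x : X ⟶ Y} {y : Y ⟶ Z} {x' : X' ⟶ Y'} {y' : Y' ⟶ Z'},
    Realizes δ x y → Realizes δ' x' y' → ∀ (a : X ⟶ X') (c : Z ⟶ Z'),
    (E.obj (Opposite.op Z)).map a δ = (E.map c.op).app X' δ' →
    ∃ b : Y ⟶ Y', x ≫ b = a ≫ x' ∧ y ≫ c = b ≫ y'
  /-- the zero extension is realized by the split sequence -/
  realizes_zero : ∀ X Z : C, Realizes (0 : (E.obj (Opposite.op Z)).obj X)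
    (biprod.inl : X ⟶ X ⊞ Z) (biprod.snd : X ⊞ Z ⟶ Z)
  /-- direct sums of extensions are realized by direct sums of sequences -/
  realizes_biprod : ∀ {X Y Z X' Y' Z' : C}
    {δ : (E.obj (Opposite.op Z)).obj X} {δ' : (E.obj (Opposite.op Z')).obj X'}
    {x : X ⟶ Y} {y : Y ⟶ Z} {x' : X' ⟶ Y'} {y' : Y' ⟶ Z'},
    Realizes δ x y → Realizes δ' x' y' →
    Realizes
      ((E.obj (Opposite.op (Z ⊞ Z'))).map (biprod.inl : X ⟶ X ⊞ X')
          ((E.map (biprod.fst : Z ⊞ Z' ⟶ Z).op).app X δ) +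
        (E.obj (Opposite.op (Z ⊞ Z'))).map (biprod.inr : X' ⟶ X ⊞ X')
          ((E.map (biprod.snd : Z ⊞ Z' ⟶ Z').op).app X' δ'))
      (biprod.map x x') (biprod.map y y')
  /-- (ET3) -/
  et3 : ∀ {X Y Z X' Y' Z' : C}
    {δ : (E.obj (Opposite.op Z)).obj X} {δ' : (E.obj (Opposite.op Z')).obj X'}
    {x : X ⟶ Y} {y : Y ⟶ Z} {x' : X' ⟶ Y'} {y' : Y' ⟶ Z'},
    Realizes δ x y → Realizes δ' x' y' → ∀ (a : X ⟶ X') (b : Y ⟶ Y'), x ≫ b = a ≫ x' →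
    ∃ c : Z ⟶ Z', (E.obj (Opposite.op Z)).map a δ = (E.map c.op).app X' δ' ∧
      y ≫ c = b ≫ y'
  /-- the dual of (ET3) -/
  et3_op : ∀ {X Y Z X' Y' Z' : C}
    {δ : (E.obj (Opposite.op Z)).obj X} {δ' : (E.obj (Opposite.op Z')).obj X'}
    {x : X ⟶ Y} {y : Y ⟶ Z} {x' : X' ⟶ Y'} {y' : Y' ⟶ Z'},
    Realizes δ x y → Realizes δ' x' y' → ∀ (b : Y ⟶ Y') (c : Z ⟶ Z'), y ≫ c = b ≫ y' →
    ∃ a : X ⟶ X', (E.obj (Opposite.op Z)).map a δ = (E.map c.op).app X' δ' ∧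
      x ≫ b = a ≫ x'
  /-- (ET4) -/
  et4 : ∀ {A B D G F : C}
    {δ : (E.obj (Opposite.op D)).obj A} {δ' : (E.obj (Opposite.op F)).obj B}
    {f : A ⟶ B} {f' : B ⟶ D} {g : B ⟶ G} {g' : G ⟶ F},
    Realizes δ f f' → Realizes δ' g g' →
    ∃ (H : C) (h' : G ⟶ H) (d : D ⟶ H) (e : H ⟶ F) (δ'' : (E.obj (Opposite.op H)).obj A),
      Realizes δ'' (f ≫ g) h' ∧ f' ≫ d = g ≫ h' ∧ h' ≫ e = g' ∧
      Realizes ((E.obj (Opposite.op F)).map f' δ') d e ∧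
      (E.map d.op).app A δ'' = δ ∧
      (E.obj (Opposite.op H)).map f δ'' = (E.map e.op).app B δ'
  /-- the dual of (ET4) -/
  et4_op : ∀ {A B D G F : C}
    {δ : (E.obj (Opposite.op A)).obj D} {δ' : (E.obj (Opposite.op B)).obj F}
    {f' : D ⟶ B} {f : B ⟶ A} {g' : F ⟶ G} {g : G ⟶ B},
    Realizes δ f' f → Realizes δ' g' g →
    ∃ (H : C) (h' : H ⟶ G) (d : H ⟶ D) (e : F ⟶ H) (δ'' : (E.obj (Opposite.op A)).obj H),
      Realizes δ'' h' (g ≫ f) ∧ d ≫ f' = h' ≫ g ∧ e ≫ h' = g' ∧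
      Realizes ((E.map f'.op).app F δ') e d ∧
      (E.obj (Opposite.op A)).map d δ'' = δ ∧
      (E.map f.op).app H δ'' = (E.obj (Opposite.op B)).map e δ'

namespace ExtriangulatedStructure

variable {C : Type u} [Category.{v} C] [Preadditive C] [HasFiniteBiproducts C]
  (T : ExtriangulatedStructure.{w} C)

/-- The group `E(Z, X)` of extensions. -/
abbrev Ext (Z X : C) : Type w := (T.E.obj (Opposite.op Z)).obj X

/-- `a_* δ`. -/
abbrev push {Z X X' : C} (a : X ⟶ X') (δ : T.Ext Z X) : T.Ext Z X' :=
  (T.E.obj (Opposite.op Z)).map a δ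

/-- `c^* δ`. -/
abbrev pull {Z Z' X : C} (c : Z' ⟶ Z) (δ : T.Ext Z X) : T.Ext Z' X :=
  (T.E.map c.op).app X δ

/-- The sequence `(x, y)` is a conflation: it realizes some extension. -/
def IsConflation {X Y Z : C} (x : X ⟶ Y) (y : Y ⟶ Z) : Prop :=
  ∃ δ : T.Ext Z X, T.Realizes δ x y

/-- Objects that are projective with respect to all conflations. -/
def IsProjective (P : C) : Prop :=
  ∀ ⦃X Y Z : C⦄ (x : X ⟶ Y) (y : Y ⟶ Z), T.IsConflation x y →
    ∀ c : P ⟶ Z, ∃ b : P ⟶ Y, b ≫ y = c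

/-- Objects that are injective with respect to all conflations. -/
def IsInjective (I : C) : Prop :=
  ∀ ⦃X Y Z : C⦄ (x : X ⟶ Y) (y : Y ⟶ Z), T.IsConflation x y →
    ∀ a : X ⟶ I, ∃ b : Y ⟶ I, x ≫ b = a

/-- `C` has enough projectives. -/
def HasEnoughProjectives : Prop :=
  ∀ Z : C, ∃ (X P : C) (x : X ⟶ P) (y : P ⟶ Z), T.IsProjective P ∧ T.IsConflation x y

/-- `C` has enough injectives. -/
def HasEnoughInjectives : Prop :=
  ∀ X : C, ∃ (I Z : C) (x : X ⟶ I) (y : I ⟶ Z), T.IsInjective I ∧ T.IsConflation x y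

/-- `𝒳 ∗ 𝒴`: the objects `M` with a conflation `X ⟶ M ⟶ Y`, `X ∈ 𝒳` and `Y ∈ 𝒴`. -/
def star (𝒳 𝒴 : ObjectProperty C) : ObjectProperty C := fun M =>
  ∃ (X Y : C) (x : X ⟶ M) (y : M ⟶ Y), 𝒳 X ∧ 𝒴 Y ∧ T.IsConflation x y

/-- The `n`-fold product `𝒳 ∗ ⋯ ∗ 𝒳`, bracketed to the left; the empty product is the class
of zero objects. -/
def iterStar (𝒳 : ObjectProperty C) : ℕ → ObjectProperty C
  | 0 => fun M => IsZero M
  | 1 => 𝒳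
  | n + 2 => T.star (iterStar 𝒳 (n + 1)) 𝒳

/-- `M` admits an `𝒳`-filtration: there are conflations `M_{i-1} ⟶ M_i ⟶ X_i` for
`0 ≤ i ≤ n` with `M_{-1} = 0 = X_0`, `M_n = M` and `X_i ∈ 𝒳` for `1 ≤ i ≤ n`.
Here `N i` stands for `M_{i-1}`. -/
def Filtered (𝒳 : ObjectProperty C) : ObjectProperty C := fun M =>
  ∃ (n : ℕ) (N X : ℕ → C), IsZero (N 0) ∧ IsZero (X 0) ∧ N (n + 1) = M ∧
    (∀ i, 1 ≤ i → i ≤ n → 𝒳 (X i)) ∧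
    ∀ i, i ≤ n → ∃ (x : N i ⟶ N (i + 1)) (y : N (i + 1) ⟶ X i), T.IsConflation x y

/-- `R`-linearity of an extriangulated structure on an `R`-category: the groups `E(Z, X)`
are `R`-modules and the functor `E` is `R`-bilinear. -/
class RLinear (R : Type*) [CommRing R] [Linear R C] where
  /-- the `R`-module structure on `E(Z, X)` -/
  module : ∀ Z X : C, Module R (T.Ext Z X)
  push_smul : ∀ {Z X X' : C} (a : X ⟶ X') (r : R) (δ : T.Ext Z X),
    T.push a (r • δ) = r • T.push a δ
  pull_smul : ∀ {Z Z' X : C} (c : Z' ⟶ Z) (r : R) (δ : T.Ext Z X),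
    T.pull c (r • δ) = r • T.pull c δ
  smul_push : ∀ {Z X X' : C} (r : R) (a : X ⟶ X') (δ : T.Ext Z X),
    T.push (r • a) δ = r • T.push a δ
  smul_pull : ∀ {Z Z' X : C} (r : R) (c : Z' ⟶ Z) (δ : T.Ext Z X),
    T.pull (r • c) δ = r • T.pull c δ

attribute [reducible, instance] RLinear.module

/-- An artin extriangulated `R`-category: `R` is a commutative artinian ring and the
extriangulated `R`-category is Hom-finite, Ext-finite and Krull–Schmidt. -/
structure IsArtin (R : Type*) [CommRing R] [Linear R C] [T.RLinear R] : Prop where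
  artinian : IsArtinianRing R
  hom_finite : ∀ X Y : C, Module.Finite R (X ⟶ Y)
  ext_finite : ∀ Z X : C, Module.Finite R (T.Ext Z X)
  krull_schmidt : ∀ X : C, ∃ (n : ℕ) (Y : Fin n → C),
    (∀ i, IsLocalRing (End (Y i))) ∧ Nonempty (X ≅ ⨁ Y)

end ExtriangulatedStructure

section

variable {C : Type u} [Category.{v} C]

/-- The class of the objects that belong to a family `Θ`. -/
def familyClass {ι : Type*} (Θ : ι → C) : ObjectProperty C := fun X => ∃ i, X = Θ i

/-- `Θ^⊕`: the objects that are finite direct sums of copies of members of `Θ`. -/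
def sumClass [Preadditive C] [HasFiniteBiproducts C] {ι : Type*} (Θ : ι → C) :
    ObjectProperty C := fun X =>
  ∃ (n : ℕ) (k : Fin n → ι), Nonempty (X ≅ ⨁ fun j => Θ (k j))

/-- Every object has an `𝒳`-precover. -/
def IsPrecovering (𝒳 : ObjectProperty C) : Prop :=
  ∀ Y : C, ∃ (X : C) (f : X ⟶ Y), 𝒳 X ∧
    ∀ X' : C, 𝒳 X' → ∀ g : X' ⟶ Y, ∃ h : X' ⟶ X, h ≫ f = g

/-- Every object has an `𝒳`-preenvelope. -/
def IsPreenveloping (𝒳 : ObjectProperty C) : Prop :=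
  ∀ Y : C, ∃ (X : C) (f : Y ⟶ X), 𝒳 X ∧
    ∀ X' : C, 𝒳 X' → ∀ g : Y ⟶ X', ∃ h : X ⟶ X', f ≫ h = g

/-- A class of objects is functorially finite if it is precovering and preenveloping. -/
def IsFunctoriallyFinite (𝒳 : ObjectProperty C) : Prop :=
  IsPrecovering 𝒳 ∧ IsPreenveloping 𝒳

end

/-! Everything passes through one intermediate class `P`, the product of the classes `Θ(i)^⊕` with
each index used once, in decreasing order. If `j ≤ i`, a conflation with left term in `Θ(j)^⊕` and
right term in `Θ(i)^⊕` splits, so these factors can be interchanged (`star_sumClass_comm`), and for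
`j = i` they merge (`star_sumClass_self_le`). Hence a new factor `Θ(i)^⊕` on the right of `P` moves
left past the smaller indices and is absorbed by its own copy (`starList_star_sumClass_le`).
Induction on filtration length puts every filtered object in `P`. Clearly `P` lies in the `t`-fold
product of `Θ^⊕`, and that product consists of filtered objects because filtered objects are closed
under extensions (`star_starPow_le`). So the three classes coincide.

Functorial finiteness is then read off from `P`: each `Θ(i)^⊕` has approximations built from
generators of Hom modules, and products inherit them by `isPrecovering_star` and
`isPreenveloping_star`. -/

namespace ExtriangulatedStructure

variable {C : Type u} [Category.{v} C] [Preadditive C] [HasFiniteBiproducts C]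
  (T : ExtriangulatedStructure.{w} C)

/-! ### Functoriality and additivity of `E` -/

lemma push_id {Z X : C} (δ : T.Ext Z X) : T.push (𝟙 X) δ = δ := by
  simp [push]

lemma push_comp {Z X X' X'' : C} (a : X ⟶ X') (b : X' ⟶ X'') (δ : T.Ext Z X) :
    T.push (a ≫ b) δ = T.push b (T.push a δ) := by
  simp [push]

lemma pull_id {Z X : C} (δ : T.Ext Z X) : T.pull (𝟙 Z) δ = δ := by
  simp [pull]

lemma pull_comp {Z Z' Z'' X : C} (c : Z'' ⟶ Z') (d : Z' ⟶ Z) (δ : T.Ext Z X) :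
    T.pull (c ≫ d) δ = T.pull c (T.pull d δ) := by
  simp [pull]

lemma push_add {Z X X' : C} (a b : X ⟶ X') (δ : T.Ext Z X) :
    T.push (a + b) δ = T.push a δ + T.push b δ := by
  have := T.additive_right Z
  simp [push, Functor.map_add]

lemma pull_add {Z Z' X : C} (c d : Z' ⟶ Z) (δ : T.Ext Z X) :
    T.pull (c + d) δ = T.pull c δ + T.pull d δ := by
  have := T.additive_left X
  have h := (T.E.flip.obj X).map_add (f := c.op) (g := d.op)
  exact congrArg (fun φ => φ.hom δ) h

lemma push_sum {ι : Type*} (s : Finset ι) {Z X X' : C} (a : ι → (X ⟶ X')) (δ : T.Ext Z X) :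
    T.push (∑ i ∈ s, a i) δ = ∑ i ∈ s, T.push (a i) δ :=
  map_sum (AddMonoidHom.mk' (fun b : X ⟶ X' => T.push b δ) fun b c => T.push_add b c δ) a s

lemma pull_sum {ι : Type*} (s : Finset ι) {Z Z' X : C} (c : ι → (Z' ⟶ Z)) (δ : T.Ext Z X) :
    T.pull (∑ i ∈ s, c i) δ = ∑ i ∈ s, T.pull (c i) δ :=
  map_sum (AddMonoidHom.mk' (fun d : Z' ⟶ Z => T.pull d δ) fun d e => T.pull_add d e δ) c s

lemma push_zero {Z X X' : C} (a : X ⟶ X') : T.push a (0 : T.Ext Z X) = 0 :=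
  map_zero ((T.E.obj (Opposite.op Z)).map a).hom

lemma pull_zero {Z Z' X : C} (c : Z' ⟶ Z) : T.pull c (0 : T.Ext Z X) = 0 :=
  map_zero ((T.E.map c.op).app X).hom

/-- Extensions between direct sums vanish if they vanish between the summands. -/
lemma ext_biproduct_eq_zero {m n : ℕ} {Z : Fin m → C} {X : Fin n → C}
    (h : ∀ i j, ∀ δ : T.Ext (Z i) (X j), δ = 0) {A B : C} (e : A ≅ ⨁ Z) (e' : B ≅ ⨁ X)
    (δ : T.Ext A B) : δ = 0 := by
  have hA : 𝟙 A = ∑ i, (e.hom ≫ biproduct.π Z i) ≫ biproduct.ι Z i ≫ e.inv := by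
    calc 𝟙 A = e.hom ≫ 𝟙 (⨁ Z) ≫ e.inv := by simp
      _ = _ := by
        rw [← biproduct.total]
        simp only [Preadditive.comp_sum, Preadditive.sum_comp, Category.assoc]
  have hB : 𝟙 B = ∑ j, (e'.hom ≫ biproduct.π X j) ≫ biproduct.ι X j ≫ e'.inv := by
    calc 𝟙 B = e'.hom ≫ 𝟙 (⨁ X) ≫ e'.inv := by simp
      _ = _ := by
        rw [← biproduct.total]
        simp only [Preadditive.comp_sum, Preadditive.sum_comp, Category.assoc]
  rw [← T.pull_id δ, hA, pull_sum]
  refine Finset.sum_eq_zero fun i _ => ?_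
  rw [pull_comp]
  generalize T.pull (biproduct.ι Z i ≫ e.inv) δ = ε
  have hε : ε = 0 := by
    rw [← T.push_id ε, hB, push_sum]
    refine Finset.sum_eq_zero fun j _ => ?_
    rw [push_comp, h i j (T.push _ ε), push_zero]
  rw [hε, pull_zero]

/-! ### Conflations -/

variable {T}

lemma IsConflation.of_iso {X Y Y' Z : C} {x : X ⟶ Y} {y : Y ⟶ Z} (h : T.IsConflation x y)
    (e : Y ≅ Y') : T.IsConflation (x ≫ e.hom) (e.inv ≫ y) := by
  obtain ⟨δ, h⟩ := h
  exact ⟨δ, (T.realizes_iff h _ _).2 ⟨e, rfl, by simp⟩⟩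

variable (T)

/-- A sequence that is isomorphic to a split sequence realizes the zero extension. -/
lemma realizes_zero_of_iso {X Y Z : C} (e : X ⊞ Z ≅ Y) (x : X ⟶ Y) (y : Y ⟶ Z)
    (hx : biprod.inl ≫ e.hom = x) (hy : e.hom ≫ y = biprod.snd) :
    T.Realizes (0 : T.Ext Z X) x y :=
  (T.realizes_iff (T.realizes_zero X Z) x y).2 ⟨e, hx, hy⟩

lemma realizes_id_left (X : C) {Z : C} (hZ : IsZero Z) :
    T.Realizes (0 : T.Ext Z X) (𝟙 X) (0 : X ⟶ Z) :=
  T.realizes_zero_of_iso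
    ⟨biprod.fst, biprod.inl, by ext <;> simp [hZ.eq_of_src _ 0], by simp⟩ _ _ (by simp)
    (hZ.eq_of_tgt _ _)

lemma realizes_id_right {X : C} (Z : C) (hX : IsZero X) :
    T.Realizes (0 : T.Ext Z X) (0 : X ⟶ Z) (𝟙 Z) :=
  T.realizes_zero_of_iso
    ⟨biprod.snd, biprod.inr, by ext <;> simp [hX.eq_of_tgt _ 0], by simp⟩ _ _ (by simp)
    (by simp)

variable {T}

/-- The dual of (ET3), applied to the conflation `M ⟶ M ⟶ 0` mapping to the given one, makes `x` a
weak kernel of `y`. -/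
lemma IsConflation.exists_lift {X Y Z M : C} {x : X ⟶ Y} {y : Y ⟶ Z}
    (h : T.IsConflation x y) (d : M ⟶ Y) (hd : d ≫ y = 0) : ∃ a : M ⟶ X, a ≫ x = d := by
  obtain ⟨δ, h⟩ := h
  obtain ⟨a, -, ha⟩ := T.et3_op (T.realizes_id_left M (isZero_zero C)) h d 0 (by simp [hd])
  exact ⟨a, by simpa using ha.symm⟩

lemma IsConflation.exists_desc {X Y Z M : C} {x : X ⟶ Y} {y : Y ⟶ Z}
    (h : T.IsConflation x y) (d : Y ⟶ M) (hd : x ≫ d = 0) : ∃ c : Z ⟶ M, y ≫ c = d := by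
  obtain ⟨δ, h⟩ := h
  obtain ⟨c, -, hc⟩ := T.et3 h (T.realizes_id_right M (isZero_zero C)) 0 d (by simp [hd])
  exact ⟨c, by simpa using hc⟩

/-- If `x : X ⟶ Y` is an inflation, then so is `(f, x) : X ⟶ D ⊞ Y` for every `f`. -/
lemma IsConflation.exists_lift_inflation {X Y Z D : C} {x : X ⟶ Y} {y : Y ⟶ Z}
    (h : T.IsConflation x y) (f : X ⟶ D) :
    ∃ (K : C) (k : Y ⊞ D ⟶ K), T.IsConflation (biprod.lift x f) k := by
  obtain ⟨δ, h⟩ := h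
  -- The morphism `(x, f)` is the split inflation `(1, f)` followed by `x ⊕ 1`, so (ET4) applies; a
  -- shear automorphism of `X ⊞ D` shows that `(1, f)` splits.
  have h₁ : T.Realizes (0 : T.Ext D X) (biprod.lift (𝟙 X) f)
      (biprod.desc (-f) (𝟙 D)) := by
    refine T.realizes_zero_of_iso
      ⟨biprod.desc (biprod.lift (𝟙 X) f) biprod.inr,
        biprod.desc (biprod.lift (𝟙 X) (-f)) biprod.inr, ?_, ?_⟩ _ _ ?_ ?_
    all_goals ext <;> simp
  have h₂ := T.realizes_biprod h (T.realizes_id_left D (isZero_zero C))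
  obtain ⟨K, k, -, -, ε, hε, -⟩ := T.et4 h₁ h₂
  refine ⟨K, k, ε, ?_⟩
  convert hε using 1
  ext <;> simp

/-- If `y : Y ⟶ Z` is a deflation, then so is `(y, f) : Y ⊞ D ⟶ Z` for every `f`. -/
lemma IsConflation.exists_desc_deflation {X Y Z D : C} {x : X ⟶ Y} {y : Y ⟶ Z}
    (h : T.IsConflation x y) (f : D ⟶ Z) :
    ∃ (K : C) (k : K ⟶ Y ⊞ D), T.IsConflation k (biprod.desc y f) := by
  obtain ⟨δ, h⟩ := h
  have h₁ : T.Realizes (0 : T.Ext Z D) (biprod.lift (-f) (𝟙 D))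
      (biprod.desc (𝟙 Z) f) := by
    refine T.realizes_zero_of_iso
      ⟨biprod.desc (biprod.lift (-f) (𝟙 D)) biprod.inl,
        biprod.desc biprod.inr (biprod.lift (𝟙 D) f), ?_, ?_⟩ _ _ ?_ ?_
    all_goals ext <;> simp
  have h₂ := T.realizes_biprod h (T.realizes_id_right D (isZero_zero C))
  obtain ⟨K, k, -, -, ε, hε, -⟩ := T.et4_op h₁ h₂
  refine ⟨K, k, ε, ?_⟩
  convert hε using 1
  ext <;> simp

/-! ### Extension products of classes of objects -/

lemma star_mono {𝒳 𝒳' 𝒴 𝒴' : ObjectProperty C} (hX : 𝒳 ≤ 𝒳') (hY : 𝒴 ≤ 𝒴') :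
    T.star 𝒳 𝒴 ≤ T.star 𝒳' 𝒴' :=
  fun _ ⟨X, Y, x, y, h, h', hxy⟩ => ⟨X, Y, x, y, hX _ h, hY _ h', hxy⟩

lemma star_of_iso {𝒳 𝒴 : ObjectProperty C} {M N : C} (e : M ≅ N) (h : T.star 𝒳 𝒴 M) :
    T.star 𝒳 𝒴 N := by
  obtain ⟨X, Y, x, y, hX, hY, hxy⟩ := h
  exact ⟨X, Y, _, _, hX, hY, hxy.of_iso e⟩

/-- The two inclusions are (ET4) and its dual. -/
lemma star_assoc (𝒳 𝒴 𝒵 : ObjectProperty C) :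
    T.star (T.star 𝒳 𝒴) 𝒵 = T.star 𝒳 (T.star 𝒴 𝒵) := by
  refine le_antisymm ?_ ?_
  · rintro M ⟨B, F, g, g', ⟨A, D, f, f', hA, hD, δ, hδ⟩, hF, δ', hδ'⟩
    obtain ⟨H, h', d, e, δ'', h₁, -, -, h₂, -⟩ := T.et4 hδ hδ'
    exact ⟨A, H, _, h', hA, ⟨D, F, d, e, hD, hF, _, h₂⟩, _, h₁⟩
  · rintro M ⟨F, B, g', g, hF, ⟨D, A, f', f, hD, hA, δ, hδ⟩, δ', hδ'⟩
    obtain ⟨H, h', d, e, δ'', h₁, -, -, h₂, -⟩ := T.et4_op hδ hδ'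
    exact ⟨H, A, h', _, ⟨F, D, e, d, hF, hD, _, h₂⟩, hA, _, h₁⟩

lemma le_isZero_star (𝒳 : ObjectProperty C) : 𝒳 ≤ T.star (fun M => IsZero M) 𝒳 :=
  fun X hX => ⟨_, X, 0, 𝟙 X, isZero_zero C, hX, _, T.realizes_id_right X (isZero_zero C)⟩

lemma le_star_isZero (𝒳 : ObjectProperty C) : 𝒳 ≤ T.star 𝒳 (fun M => IsZero M) :=
  fun X hX => ⟨X, _, 𝟙 X, 0, hX, isZero_zero C, _, T.realizes_id_left X (isZero_zero C)⟩

/-- The extension is zero because the identity of `X` is, so the sequence is equivalent to the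
trivial one. -/
lemma IsConflation.nonempty_iso_of_isZero_left {X Y Z : C} {x : X ⟶ Y} {y : Y ⟶ Z}
    (h : T.IsConflation x y) (hX : IsZero X) : Nonempty (Z ≅ Y) := by
  obtain ⟨δ, h⟩ := h
  have hδ : δ = 0 := by
    have h0 : T.push (0 : X ⟶ X) δ = 0 := by
      have := T.push_add (0 : X ⟶ X) 0 δ
      rwa [add_zero, left_eq_add] at this
    rw [← T.push_id δ, hX.eq_of_src (𝟙 X) 0, h0]
  subst hδ
  obtain ⟨b, -, -⟩ := (T.realizes_iff (T.realizes_id_right Z hX) x y).1 h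
  exact ⟨b⟩

lemma IsConflation.nonempty_iso_of_isZero_right {X Y Z : C} {x : X ⟶ Y} {y : Y ⟶ Z}
    (h : T.IsConflation x y) (hZ : IsZero Z) : Nonempty (X ≅ Y) := by
  obtain ⟨δ, h⟩ := h
  have hδ : δ = 0 := by
    have h0 : T.pull (0 : Z ⟶ Z) δ = 0 := by
      have := T.pull_add (0 : Z ⟶ Z) 0 δ
      rwa [add_zero, left_eq_add] at this
    rw [← T.pull_id δ, hZ.eq_of_src (𝟙 Z) 0, h0]
  subst hδ
  obtain ⟨b, -, -⟩ := (T.realizes_iff (T.realizes_id_left X hZ) x y).1 h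
  exact ⟨b⟩

end ExtriangulatedStructure

/-! ### Finite direct sums -/

section

variable {C : Type u} [Category.{v} C] [Preadditive C] [HasFiniteBiproducts C]

/-- A direct sum over `Fin (m + n)` splits into two blocks. -/
noncomputable def biproductFinAddIso {m n : ℕ} (f : Fin (m + n) → C) :
    (⨁ f) ≅ (⨁ fun i : Fin m => f (Fin.castAdd n i)) ⊞ (⨁ fun j : Fin n => f (Fin.natAdd m j)) where
  hom := biprod.lift (biproduct.lift fun i => biproduct.π f (Fin.castAdd n i))
    (biproduct.lift fun j => biproduct.π f (Fin.natAdd m j))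
  inv := biprod.desc (biproduct.desc fun i => biproduct.ι f (Fin.castAdd n i))
    (biproduct.desc fun j => biproduct.ι f (Fin.natAdd m j))
  hom_inv_id := by
    rw [biprod.lift_desc, biproduct.lift_desc, biproduct.lift_desc, ← biproduct.total,
      Fin.sum_univ_add]
  inv_hom_id := by
    ext i j <;> simp [biproduct.ι_π, Fin.ext_iff]
    all_goals intro h; omega

variable {ι : Type*} {Θ : ι → C}

lemma sumClass_of_iso {M N : C} (e : M ≅ N) (h : sumClass Θ M) : sumClass Θ N := by
  obtain ⟨n, k, ⟨e'⟩⟩ := h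
  exact ⟨n, k, ⟨e.symm ≪≫ e'⟩⟩

lemma sumClass_self (i : ι) : sumClass Θ (Θ i) :=
  ⟨1, fun _ => i, ⟨(biproductUniqueIso fun _ : Fin 1 => Θ i).symm⟩⟩

lemma sumClass_biprod {M N : C} (hM : sumClass Θ M) (hN : sumClass Θ N) :
    sumClass Θ (M ⊞ N) := by
  obtain ⟨m, k, ⟨e⟩⟩ := hM
  obtain ⟨n, l, ⟨e'⟩⟩ := hN
  refine ⟨m + n, Fin.append k l, ⟨biprod.mapIso e e' ≪≫ biprod.mapIso ?_ ?_ ≪≫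
    (biproductFinAddIso fun j => Θ (Fin.append k l j)).symm⟩⟩
  · exact biproduct.mapIso fun i => eqToIso (by simp)
  · exact biproduct.mapIso fun i => eqToIso (by simp)

lemma isPrecovering_isZero : IsPrecovering (fun M : C => IsZero M) :=
  fun _ => ⟨_, 0, isZero_zero C, fun _ hX _ => ⟨0, hX.eq_of_src _ _⟩⟩

lemma isPreenveloping_isZero : IsPreenveloping (fun M : C => IsZero M) :=
  fun _ => ⟨_, 0, isZero_zero C, fun _ hX _ => ⟨0, hX.eq_of_tgt _ _⟩⟩

/-- The finite direct sums of copies of an object with finitely generated Hom modules are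
precovering. -/
lemma isPrecovering_sumClass_const (R : Type*) [CommRing R] [Linear R C] (A : C)
    (hA : ∀ Y, Module.Finite R (A ⟶ Y)) : IsPrecovering (sumClass fun _ : Unit => A) := by
  intro Y
  obtain ⟨n, s, hs⟩ := (hA Y).exists_fin
  refine ⟨⨁ fun _ : Fin n => A, biproduct.desc s, ⟨n, fun _ => (), ⟨Iso.refl _⟩⟩, ?_⟩
  -- The coefficients of `g` in the generators `s`, acting as scalars on `A`, give the
  -- factorization.
  have key : ∀ g : A ⟶ Y, ∃ h : A ⟶ ⨁ fun _ : Fin n => A, h ≫ biproduct.desc s = g := by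
    intro g
    obtain ⟨c, hc⟩ := (Submodule.mem_span_range_iff_exists_fun R).1
      (hs ▸ Submodule.mem_top : g ∈ Submodule.span R (Set.range s))
    exact ⟨biproduct.lift fun i => c i • 𝟙 A, by simpa [biproduct.lift_desc] using hc⟩
  rintro X' ⟨m, k, ⟨e⟩⟩ g
  choose h hh using fun j : Fin m =>
    key (biproduct.ι (fun _ : Fin m => A) j ≫ e.inv ≫ g)
  refine ⟨e.hom ≫ biproduct.desc h, ?_⟩
  rw [Category.assoc, ← Iso.eq_inv_comp]
  refine biproduct.hom_ext' _ _ fun j => ?_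
  simp [hh]

/-- The finite direct sums of copies of an object with finitely generated Hom modules are
preenveloping. -/
lemma isPreenveloping_sumClass_const (R : Type*) [CommRing R] [Linear R C] (A : C)
    (hA : ∀ Y, Module.Finite R (Y ⟶ A)) : IsPreenveloping (sumClass fun _ : Unit => A) := by
  intro Y
  obtain ⟨n, s, hs⟩ := (hA Y).exists_fin
  refine ⟨⨁ fun _ : Fin n => A, biproduct.lift s, ⟨n, fun _ => (), ⟨Iso.refl _⟩⟩, ?_⟩
  have key : ∀ g : Y ⟶ A, ∃ h : (⨁ fun _ : Fin n => A) ⟶ A, biproduct.lift s ≫ h = g := by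
    intro g
    obtain ⟨c, hc⟩ := (Submodule.mem_span_range_iff_exists_fun R).1
      (hs ▸ Submodule.mem_top : g ∈ Submodule.span R (Set.range s))
    exact ⟨biproduct.desc fun i => c i • 𝟙 A, by simpa [biproduct.lift_desc] using hc⟩
  rintro X' ⟨m, k, ⟨e⟩⟩ g
  choose h hh using fun j : Fin m =>
    key (g ≫ e.hom ≫ biproduct.π (fun _ : Fin m => A) j)
  refine ⟨biproduct.lift h ≫ e.inv, ?_⟩
  rw [← Category.assoc, Iso.comp_inv_eq]
  refine biproduct.hom_ext _ _ fun j => ?_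
  simp [hh]

end

namespace ExtriangulatedStructure

variable {C : Type u} [Category.{v} C] [Preadditive C] [HasFiniteBiproducts C]
  {T : ExtriangulatedStructure.{w} C}

/-! ### Approximations by extension products -/

/-- With enough injectives, the extension product of precovering classes is precovering. -/
lemma isPrecovering_star (hinj : T.HasEnoughInjectives) {𝒳 𝒴 : ObjectProperty C}
    (hX : IsPrecovering 𝒳) (hY : IsPrecovering 𝒴) : IsPrecovering (T.star 𝒳 𝒴) := by
  intro D
  obtain ⟨X₀, f, hX₀, hf⟩ := hX D
  obtain ⟨I, Z, i, p, hI, hip⟩ := hinj X₀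
  -- The map `f` need not be an inflation; adding the component into the injective `I` makes it one.
  -- The approximation of `D` is obtained by pulling this conflation back along a precover of `K`.
  obtain ⟨K, k, hk⟩ := hip.exists_lift_inflation f
  obtain ⟨Y₀, π, hY₀, hπ⟩ := hY K
  have hk' := hk
  obtain ⟨κ, hκ⟩ := hk'
  obtain ⟨M₀, x₀, y₀, hM₀⟩ := T.exists_realizes (T.pull π κ)
  obtain ⟨m, hm₁, hm₂⟩ := T.realization hM₀ hκ (𝟙 X₀) π (T.push_id _)
  rw [Category.id_comp] at hm₁
  refine ⟨M₀, m ≫ biprod.snd, ⟨X₀, Y₀, x₀, y₀, hX₀, hY₀, _, hM₀⟩, ?_⟩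
  rintro M ⟨X, Y, x, y, hX, hY, hxy⟩ g
  obtain ⟨a, ha⟩ := hf X hX (x ≫ g)
  obtain ⟨g', hg'⟩ := hI x y hxy (a ≫ i)
  have hlift : x ≫ biprod.lift g' g = a ≫ biprod.lift i f := by
    ext <;> simp [ha, hg']
  obtain ⟨δ, hδ⟩ := hxy
  obtain ⟨c, hc, hc'⟩ := T.et3 hδ hκ a (biprod.lift g' g) hlift
  obtain ⟨c', rfl⟩ := hπ Y hY c
  obtain ⟨b, hb, hb'⟩ := T.realization hδ hM₀ a c' (hc.trans (T.pull_comp c' π κ))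
  -- `b ≫ m` and `(g', g)` agree only after composing with `k`; their difference factors through
  -- `X₀` and is subtracted from `b`.
  obtain ⟨h, hh⟩ := hk.exists_lift (b ≫ m - biprod.lift g' g) (by
    rw [Preadditive.sub_comp, Category.assoc, ← hm₂, ← reassoc_of% hb', hc', sub_self])
  refine ⟨b - h ≫ x₀, ?_⟩
  have hbm : (b - h ≫ x₀) ≫ m = biprod.lift g' g := by
    rw [Preadditive.sub_comp, Category.assoc, hm₁, hh, sub_sub_cancel]
  rw [reassoc_of% hbm, biprod.lift_snd]

/-- With enough projectives, the extension product of preenveloping classes is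
preenveloping. -/
lemma isPreenveloping_star (hproj : T.HasEnoughProjectives) {𝒳 𝒴 : ObjectProperty C}
    (hX : IsPreenveloping 𝒳) (hY : IsPreenveloping 𝒴) : IsPreenveloping (T.star 𝒳 𝒴) := by
  intro D
  obtain ⟨Y₀, f, hY₀, hf⟩ := hY D
  obtain ⟨Z, P, i, p, hP, hip⟩ := hproj Y₀
  -- Dually, the projective summand turns `f` into a deflation, whose conflation is pushed out along
  -- a preenvelope of `K`.
  obtain ⟨K, k, hk⟩ := hip.exists_desc_deflation f
  obtain ⟨X₀, π, hX₀, hπ⟩ := hX K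
  have hk' := hk
  obtain ⟨κ, hκ⟩ := hk'
  obtain ⟨M₀, x₀, y₀, hM₀⟩ := T.exists_realizes (T.push π κ)
  obtain ⟨m, hm₁, hm₂⟩ := T.realization hκ hM₀ π (𝟙 Y₀) (T.pull_id _).symm
  rw [Category.comp_id] at hm₂
  refine ⟨M₀, biprod.inr ≫ m, ⟨X₀, Y₀, x₀, y₀, hX₀, hY₀, _, hM₀⟩, ?_⟩
  rintro M ⟨X, Y, x, y, hX, hY, hxy⟩ g
  obtain ⟨c, hc⟩ := hf Y hY (g ≫ y)
  obtain ⟨g', hg'⟩ := hP x y hxy (p ≫ c)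
  have hdesc : biprod.desc p f ≫ c = biprod.desc g' g ≫ y := by
    ext <;> simp [hc, hg']
  obtain ⟨δ, hδ⟩ := hxy
  obtain ⟨a, ha, ha'⟩ := T.et3_op hκ hδ (biprod.desc g' g) c hdesc
  obtain ⟨a', rfl⟩ := hπ X hX a
  obtain ⟨b, hb, hb'⟩ := T.realization hM₀ hδ a' c ((T.push_comp π a' κ).symm.trans ha)
  obtain ⟨h, hh⟩ := hk.exists_desc (m ≫ b - biprod.desc g' g) (by
    rw [Preadditive.comp_sub, reassoc_of% hm₁, hb, ha', Category.assoc, sub_self])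
  refine ⟨b - y₀ ≫ h, ?_⟩
  have hbm : m ≫ (b - y₀ ≫ h) = biprod.desc g' g := by
    rw [Preadditive.comp_sub, ← reassoc_of% hm₂, hh, sub_sub_cancel]
  rw [Category.assoc, hbm, biprod.inr_desc]

/-! ### Iterated extension products and filtrations -/

variable (T)

/-- The `n`-fold extension product, starting from the class of zero objects. -/
def starPow (𝒳 : ObjectProperty C) : ℕ → ObjectProperty C
  | 0 => fun M => IsZero M
  | n + 1 => T.star (starPow 𝒳 n) 𝒳

/-- The extension product of a list of classes, bracketed to the right. -/
def starList : List (ObjectProperty C) → ObjectProperty C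
  | [] => fun M => IsZero M
  | 𝒳 :: l => T.star 𝒳 (starList l)

variable {T}

lemma isZero_star_le {𝒳 : ObjectProperty C} (h𝒳 : ∀ {M N : C}, (M ≅ N) → 𝒳 M → 𝒳 N) :
    T.star (fun M => IsZero M) 𝒳 ≤ 𝒳 := by
  rintro M ⟨X, Y, x, y, hX, hY, hxy⟩
  obtain ⟨e⟩ := hxy.nonempty_iso_of_isZero_left hX
  exact h𝒳 e hY

lemma star_isZero_le {𝒳 : ObjectProperty C} (h𝒳 : ∀ {M N : C}, (M ≅ N) → 𝒳 M → 𝒳 N) :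
    T.star 𝒳 (fun M => IsZero M) ≤ 𝒳 := by
  rintro M ⟨X, Y, x, y, hX, hY, hxy⟩
  obtain ⟨e⟩ := hxy.nonempty_iso_of_isZero_right hY
  exact h𝒳 e hX

lemma starPow_of_iso {𝒳 : ObjectProperty C} {n : ℕ} {M N : C} (e : M ≅ N)
    (h : T.starPow 𝒳 n M) : T.starPow 𝒳 n N := by
  cases n with
  | zero => exact IsZero.of_iso h e.symm
  | succ n => exact star_of_iso e h

lemma iterStar_eq_starPow {𝒳 : ObjectProperty C}
    (h𝒳 : ∀ {M N : C}, (M ≅ N) → 𝒳 M → 𝒳 N) (n : ℕ) :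
    T.iterStar 𝒳 n = T.starPow 𝒳 n := by
  match n with
  | 0 => rfl
  | 1 => exact le_antisymm (le_isZero_star 𝒳) (isZero_star_le h𝒳)
  | n + 2 => exact congrArg (fun 𝒴 => T.star 𝒴 𝒳) (iterStar_eq_starPow h𝒳 (n + 1))

/-- Associativity peels the factors off the right-hand power one at a time. This is
extension-closure of the filtered objects. -/
lemma star_starPow_le (𝒳 : ObjectProperty C) (m n : ℕ) :
    T.star (T.starPow 𝒳 m) (T.starPow 𝒳 n) ≤ T.starPow 𝒳 (m + n) := by
  induction n with
  | zero => exact star_isZero_le starPow_of_iso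
  | succ n ih =>
    exact (star_assoc _ _ _).ge.trans (star_mono ih le_rfl)

lemma filtered_iff (𝒳 : ObjectProperty C) (M : C) :
    T.Filtered 𝒳 M ↔ ∃ n, T.starPow 𝒳 n M := by
  constructor
  · rintro ⟨n, N, X, hN, hX, rfl, h𝒳, h⟩
    refine ⟨n, ?_⟩
    have key : ∀ i, i ≤ n → T.starPow 𝒳 i (N (i + 1)) := by
      intro i
      induction i with
      | zero =>
        intro _
        obtain ⟨x, y, hxy⟩ := h 0 (Nat.zero_le _)
        obtain ⟨e⟩ := hxy.nonempty_iso_of_isZero_left hN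
        exact IsZero.of_iso hX e.symm
      | succ i ih =>
        intro hi
        obtain ⟨x, y, hxy⟩ := h (i + 1) hi
        exact ⟨_, _, x, y, ih (by omega), h𝒳 _ (by omega) hi, hxy⟩
    exact key n le_rfl
  · rintro ⟨n, hn⟩
    induction n generalizing M with
    | zero =>
      refine ⟨0, fun _ => M, fun _ => M, hn, hn, rfl, by omega, fun i _ => ?_⟩
      exact ⟨𝟙 M, 0, _, T.realizes_id_left M hn⟩
    | succ n ih =>
      obtain ⟨L, Y, x, y, hL, hY, hxy⟩ := hn
      obtain ⟨m, N, X, hN, hX, rfl, h𝒳, h⟩ := ih L hL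
      -- `N` is shifted by one against `X`, so the new top object enters at index `m + 2` and its
      -- factor at `m + 1`.
      let N' : ℕ → C := fun i => if i ≤ m + 1 then N i else M
      let X' : ℕ → C := fun i => if i ≤ m then X i else Y
      have hN' : ∀ {i}, i ≤ m + 1 → N' i = N i := fun hi => if_pos hi
      have hX' : ∀ {i}, i ≤ m → X' i = X i := fun hi => if_pos hi
      have hNlast : N' (m + 1 + 1) = M := if_neg (by omega)
      have hXlast : X' (m + 1) = Y := if_neg (by omega)
      refine ⟨m + 1, N', X', ?_, ?_, hNlast, fun i hi hi' => ?_, fun i hi => ?_⟩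
      · rwa [hN' (Nat.zero_le _)]
      · rwa [hX' (Nat.zero_le _)]
      · obtain hi' | rfl := Nat.le_succ_iff.1 hi'
        · rw [hX' hi']
          exact h𝒳 i hi hi'
        · rwa [hXlast]
      · obtain hi | rfl := Nat.le_succ_iff.1 hi
        · rw [hX' hi, hN' (by omega), hN' (by omega)]
          exact h i hi
        · rw [hXlast, hNlast, hN' le_rfl]
          exact ⟨x, y, hxy⟩

end ExtriangulatedStructure

/-! ### Products of lists of classes, and splitting -/

namespace ExtriangulatedStructure

variable {C : Type u} [Category.{v} C] [Preadditive C] [HasFiniteBiproducts C]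
  {T : ExtriangulatedStructure.{w} C}

lemma exists_starPow_of_starPow {𝒳 𝒴 : ObjectProperty C} (h : ∀ M, 𝒴 M → ∃ m, T.starPow 𝒳 m M) (n : ℕ)
    {M : C} (hM : T.starPow 𝒴 n M) : ∃ m, T.starPow 𝒳 m M := by
  induction n generalizing M with
  | zero => exact ⟨0, hM⟩
  | succ n ih =>
    obtain ⟨L, Y, x, y, hL, hY, hxy⟩ := hM
    obtain ⟨m, hm⟩ := ih hL
    obtain ⟨m', hm'⟩ := h Y hY
    exact ⟨m + m', star_starPow_le 𝒳 m m' M ⟨L, Y, x, y, hm, hm', hxy⟩⟩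

/-- Split conflations peel off the summands one at a time. -/
lemma starPow_familyClass_of_sumClass {ι : Type*} {Θ : ι → C} {M : C} (hM : sumClass Θ M) :
    ∃ n, T.starPow (familyClass Θ) n M := by
  obtain ⟨n, k, ⟨e⟩⟩ := hM
  suffices h : T.starPow (familyClass Θ) n (⨁ fun j => Θ (k j)) from
    ⟨n, starPow_of_iso e.symm h⟩
  clear e
  induction n with
  | zero => exact (IsZero.iff_id_eq_zero _).2 (biproduct.hom_ext _ _ fun j => j.elim0)
  | succ n ih =>
    let e := biproductUniqueIso fun j : Fin 1 => Θ (k (Fin.natAdd n j))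
    refine star_of_iso (biproductFinAddIso (n := 1) fun j => Θ (k j)).symm
      ⟨_, _, biprod.inl, biprod.snd ≫ e.hom, ih fun i => k (Fin.castAdd 1 i), ⟨_, rfl⟩, 0, ?_⟩
    refine T.realizes_zero_of_iso (biprod.mapIso (Iso.refl _) e.symm) _ _ ?_ ?_
    · rw [biprod.mapIso_hom, biprod.inl_map, Iso.refl_hom, Category.id_comp]
    · rw [biprod.mapIso_hom, biprod.map_snd_assoc, Iso.symm_hom, e.inv_hom_id, Category.comp_id]

lemma isPrecovering_starList (hinj : T.HasEnoughInjectives) {l : List (ObjectProperty C)}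
    (hl : ∀ 𝒳 ∈ l, IsPrecovering 𝒳) : IsPrecovering (T.starList l) := by
  induction l with
  | nil => exact isPrecovering_isZero
  | cons 𝒳 l ih =>
    rw [List.forall_mem_cons] at hl
    exact isPrecovering_star hinj hl.1 (ih hl.2)

lemma isPreenveloping_starList (hproj : T.HasEnoughProjectives) {l : List (ObjectProperty C)}
    (hl : ∀ 𝒳 ∈ l, IsPreenveloping 𝒳) : IsPreenveloping (T.starList l) := by
  induction l with
  | nil => exact isPreenveloping_isZero
  | cons 𝒳 l ih =>
    rw [List.forall_mem_cons] at hl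
    exact isPreenveloping_star hproj hl.1 (ih hl.2)

lemma starList_le_starPow {𝒴 : ObjectProperty C} {l : List (ObjectProperty C)}
    (hl : ∀ 𝒳 ∈ l, 𝒳 ≤ 𝒴) : T.starList l ≤ T.starPow 𝒴 l.length := by
  induction l with
  | nil => exact le_rfl
  | cons 𝒳 l ih =>
    rw [List.forall_mem_cons] at hl
    have h₁ : 𝒳 ≤ T.starPow 𝒴 1 := hl.1.trans (le_isZero_star 𝒴)
    rw [List.length_cons, add_comm]
    exact (star_mono h₁ (ih hl.2)).trans (star_starPow_le 𝒴 1 l.length)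

/-- A class that commutes with every factor of a product commutes with the product. -/
lemma starList_star_le {𝒴 : ObjectProperty C} (h𝒴 : ∀ {M N : C}, (M ≅ N) → 𝒴 M → 𝒴 N)
    {l : List (ObjectProperty C)} (hl : ∀ 𝒳 ∈ l, T.star 𝒳 𝒴 ≤ T.star 𝒴 𝒳) :
    T.star (T.starList l) 𝒴 ≤ T.star 𝒴 (T.starList l) := by
  induction l with
  | nil => exact (isZero_star_le h𝒴).trans (le_star_isZero 𝒴)
  | cons 𝒳 l ih =>
    rw [List.forall_mem_cons] at hl
    calc T.star (T.star 𝒳 (T.starList l)) 𝒴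
        = T.star 𝒳 (T.star (T.starList l) 𝒴) := star_assoc _ _ _
      _ ≤ T.star 𝒳 (T.star 𝒴 (T.starList l)) := star_mono le_rfl (ih hl.2)
      _ = T.star (T.star 𝒳 𝒴) (T.starList l) := (star_assoc _ _ _).symm
      _ ≤ T.star (T.star 𝒴 𝒳) (T.starList l) := star_mono hl.1 le_rfl
      _ = T.star 𝒴 (T.star 𝒳 (T.starList l)) := star_assoc _ _ _

/-- A conflation whose extension group vanishes splits. -/
lemma IsConflation.nonempty_iso_biprod {X Y Z : C} {x : X ⟶ Y} {y : Y ⟶ Z}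
    (h : T.IsConflation x y) (h0 : ∀ δ : T.Ext Z X, δ = 0) : Nonempty (X ⊞ Z ≅ Y) := by
  obtain ⟨δ, h⟩ := h
  obtain rfl := h0 δ
  obtain ⟨b, -, -⟩ := (T.realizes_iff (T.realizes_zero X Z) x y).1 h
  exact ⟨b⟩

section

variable {A B : C}

lemma IsConflation.nonempty_iso_biprod_of_sumClass (h : ∀ δ : T.Ext B A, δ = 0)
    {X Y Z : C} {x : X ⟶ Y} {y : Y ⟶ Z} (hxy : T.IsConflation x y)
    (hX : sumClass (fun _ : Unit => A) X) (hZ : sumClass (fun _ : Unit => B) Z) :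
    Nonempty (X ⊞ Z ≅ Y) := by
  obtain ⟨m, k, ⟨e⟩⟩ := hX
  obtain ⟨n, l, ⟨e'⟩⟩ := hZ
  exact hxy.nonempty_iso_biprod (T.ext_biproduct_eq_zero (fun _ _ => h) e' e)

lemma star_sumClass_comm (h : ∀ δ : T.Ext B A, δ = 0) :
    T.star (sumClass fun _ : Unit => A) (sumClass fun _ : Unit => B) ≤
      T.star (sumClass fun _ : Unit => B) (sumClass fun _ : Unit => A) := by
  rintro M ⟨X, Z, x, y, hX, hZ, hxy⟩
  obtain ⟨e⟩ := hxy.nonempty_iso_biprod_of_sumClass h hX hZ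
  exact star_of_iso (biprod.braiding Z X ≪≫ e)
    ⟨Z, X, biprod.inl, biprod.snd, hZ, hX, _, T.realizes_zero Z X⟩

lemma star_sumClass_self_le (h : ∀ δ : T.Ext A A, δ = 0) :
    T.star (sumClass fun _ : Unit => A) (sumClass fun _ : Unit => A) ≤
      sumClass fun _ : Unit => A := by
  rintro M ⟨X, Z, x, y, hX, hZ, hxy⟩
  obtain ⟨e⟩ := hxy.nonempty_iso_biprod_of_sumClass h hX hZ
  exact sumClass_of_iso e (sumClass_biprod hX hZ)

end

/-! ### Absorption of factors by a sorted product -/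

section

variable {ι : Type*} {Θ : ι → C} {r : ι → ι → Prop}

/-- If the extensions of `Θ i` by `Θ j` vanish whenever `r i j`, then the product of the classes
`(Θ i)^⊕` along an `r`-sorted list absorbs each of its factors. -/
lemma starList_star_sumClass_le (hr : ∀ i, r i i)
    (hΘ : ∀ i j, r i j → ∀ δ : T.Ext (Θ i) (Θ j), δ = 0)
    {l : List ι} (hl : l.Pairwise r) {i : ι} (hi : i ∈ l) :
    T.star (T.starList (l.map fun j => sumClass fun _ : Unit => Θ j))
        (sumClass fun _ : Unit => Θ i) ≤
      T.starList (l.map fun j => sumClass fun _ : Unit => Θ j) := by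
  induction l with
  | nil => simp at hi
  | cons a l ih =>
    rw [List.pairwise_cons] at hl
    rw [List.map_cons]
    refine (star_assoc _ _ _).le.trans ?_
    -- If `i` recurs in the tail, the tail absorbs the factor. Otherwise `i` is the head: the factor
    -- commutes past the whole tail and merges with the head.
    by_cases hil : i ∈ l
    · exact star_mono le_rfl (ih hl.2 hil)
    · obtain rfl : i = a := by simpa [hil] using hi
      refine (star_mono le_rfl (starList_star_le sumClass_of_iso ?_)).trans
        ((star_assoc _ _ _).ge.trans (star_mono (star_sumClass_self_le (hΘ i i (hr i))) le_rfl))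
      intro 𝒳 h𝒳
      obtain ⟨j, hj, rfl⟩ := List.mem_map.1 h𝒳
      exact star_sumClass_comm (hΘ i j (hl.1 j hj))

lemma starList_sumClass_of_isZero (l : List ι) {M : C} (hM : IsZero M) :
    T.starList (l.map fun j => sumClass fun _ : Unit => Θ j) M := by
  induction l with
  | nil => exact hM
  | cons a l ih =>
    have h0 : sumClass (fun _ : Unit => Θ a) M :=
      ⟨0, Fin.elim0, ⟨hM.iso ((IsZero.iff_id_eq_zero _).2
        (biproduct.hom_ext _ _ fun j => j.elim0))⟩⟩
    exact ⟨M, M, 𝟙 M, 0, h0, ih, _, T.realizes_id_left M hM⟩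

lemma starPow_familyClass_le (hr : ∀ i, r i i)
    (hΘ : ∀ i j, r i j → ∀ δ : T.Ext (Θ i) (Θ j), δ = 0)
    {l : List ι} (hl : l.Pairwise r) (hmem : ∀ i, i ∈ l) (n : ℕ) :
    T.starPow (familyClass Θ) n ≤
      T.starList (l.map fun j => sumClass fun _ : Unit => Θ j) := by
  induction n with
  | zero => exact fun M hM => starList_sumClass_of_isZero l hM
  | succ n ih =>
    rintro M ⟨L, Y, x, y, hL, ⟨i, rfl⟩, hxy⟩
    exact starList_star_sumClass_le hr hΘ hl (hmem i) M
      ⟨L, _, x, y, ih L hL, sumClass_self (Θ := fun _ : Unit => Θ i) (), hxy⟩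

end

end ExtriangulatedStructure

lemma exists_list_pairwise_ge (ι : Type*) [Fintype ι] [LinearOrder ι] :
    ∃ l : List ι, l.length = Fintype.card ι ∧ (∀ i, i ∈ l) ∧ l.Pairwise (· ≥ ·) :=
  ⟨Finset.univ.sort (· ≥ ·), by simp, by simp, Finset.pairwise_sort _ _⟩

open ExtriangulatedStructure in
theorem theorem3p11 {C : Type u} [Category.{v} C] [Preadditive C] [HasFiniteBiproducts C]
    {R : Type*} [CommRing R] [Linear R C]
    (T : ExtriangulatedStructure.{w} C) [T.RLinear R] (hT : T.IsArtin R)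
    (hproj : T.HasEnoughProjectives) (hinj : T.HasEnoughInjectives)
    {t : ℕ} (Θ : Fin t → C) (ord : LinearOrder (Fin t))
    (hΘ : ∀ i j : Fin t, ord.le i j → ∀ δ : T.Ext (Θ j) (Θ i), δ = 0) :
    T.Filtered (familyClass Θ) = T.iterStar (sumClass Θ) t ∧
      IsFunctoriallyFinite (T.Filtered (familyClass Θ)) := by
  obtain ⟨l, hlen, hmem, hl⟩ := @exists_list_pairwise_ge (Fin t) _ ord
  rw [Fintype.card_fin] at hlen
  set P := T.starList (l.map fun j => sumClass fun _ : Unit => Θ j)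
  have h₁ : T.Filtered (familyClass Θ) ≤ P := fun M hM => by
    obtain ⟨n, hn⟩ := (filtered_iff _ _).1 hM
    -- The list must decrease: vanishing holds for a right term of larger index, which is what lets
    -- that factor move left.
    exact starPow_familyClass_le (r := fun a b => ord.le b a) ord.le_refl (fun i j hij => hΘ j i hij) hl hmem n M hn
  have h₂ : P ≤ T.iterStar (sumClass Θ) t := by
    rw [iterStar_eq_starPow sumClass_of_iso]
    have h := T.starList_le_starPow (𝒴 := sumClass Θ)
      (l := l.map fun j => sumClass fun _ : Unit => Θ j) (by
        intro 𝒳 h𝒳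
        obtain ⟨i, -, rfl⟩ := List.mem_map.1 h𝒳
        rintro M ⟨n, k, he⟩
        exact ⟨n, fun _ => i, he⟩)
    rwa [List.length_map, hlen] at h
  have h₃ : T.iterStar (sumClass Θ) t ≤ T.Filtered (familyClass Θ) := fun M hM => by
    rw [iterStar_eq_starPow sumClass_of_iso] at hM
    exact (filtered_iff _ _).2
      (exists_starPow_of_starPow (fun _ => starPow_familyClass_of_sumClass) t hM)
  have hFP : T.Filtered (familyClass Θ) = P := le_antisymm h₁ (h₂.trans h₃)
  refine ⟨le_antisymm (h₁.trans h₂) h₃, ?_⟩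
  rw [hFP]
  constructor
  · refine isPrecovering_starList hinj fun 𝒳 h𝒳 => ?_
    obtain ⟨i, -, rfl⟩ := List.mem_map.1 h𝒳
    exact isPrecovering_sumClass_const R (Θ i) fun Y => hT.hom_finite _ _
  · refine isPreenveloping_starList hproj fun 𝒳 h𝒳 => ?_
    obtain ⟨i, -, rfl⟩ := List.mem_map.1 h𝒳
    exact isPreenveloping_sumClass_const R (Θ i) fun Y => hT.hom_finite _ _
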